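/- A sequence $x=(x_1,\dots,x_n)$, $n\ge 1$, of nonnegative integers is an ascent sequence if $x_1=0$ and $x_i\le 1+\operatorname{asc}(x_1,\dots,x_{i-1})$ for $2\le i\le n$, where $\operatorname{asc}(y_1,\dots,y_k)=|\{1\le j<k : y_j<y_{j+1}\}|$. It is a restricted ascent sequence (in the sense of Kitaev and Remmel) if moreover $x_i\ge \max(x_1,\dots,x_{i-1})-1$ for $2\le i\le n$. To an ascent sequence $x$ associate a multiset of $n$ intervals with integer endpoints, the intervals being ordered by "lies completely to the left of"; the resulting $n$-element interval order is $\Psi^{-1}(x)$. The multiset is built term by term. The sequence $(0)$ gives $\{[0,0]\}$. If $(x_1,\dots,x_{k-1})$ gives $Q$, let $\ell$ be the largest right endpoint in $Q$, let $\ell^*$ be the smallest left endpoint of an interval of $Q$ with right endpoint $\ell$, and put $i=x_k$. Then $(x_1,\dots,x_k)$ gives the following multiset. - If $i\le \ell^*$, add $[i,\ell]$ to $Q$. - If $i=\ell+1$, add $[\ell+1,\ell+1]$ to $Q$. - If $\ell^*<i\le \ell$, replace each $[\lambda,\rho]$ in $Q$ by $[\lambda,\rho+1]$ if $\lambda<i\le\rho<\ell$,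 by $[\lambda+1,\rho+1]$ if $i\le\lambda$, and by $[\lambda,i]$ if $\lambda<i$ and $\rho=\ell$, leave the other intervals unchanged, and then add $[i,\ell+1]$. A finite poset $P$ is a semiorder if one can assign to its elements closed bounded real intervals, all of the same length, so that $p<q$ in $P$ if and only if the interval of $p$ lies completely to the left of the interval of $q$. Theorem. Let $P$ be a nonempty finite semiorder. Then there is exactly one ascent sequence $\Psi(P)=(x_1,\dots,x_n)$ whose interval order $\Psi^{-1}(x_1,\dots,x_n)$ is isomorphic to $P$, and $\Psi(P)$ is a restricted ascent sequence if and only if $P$ is hereditary, that is, if and only if $\Psi^{-1}(x_1,\dots,x_i)$ is a semiorder for every $1\le i\le n$. -/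

import Mathlib

/-- A strict order `lt` is the strict order of a semiorder: it has a representation by closed bounded
real intervals `[l x, r x]`, all of the same length, with `lt x y` iff the interval of `x` lies
completely to the left of the interval of `y`. -/
def IsSemiorder {X : Type*} (lt : X → X → Prop) : Prop :=
  ∃ l r : X → ℝ, (∀ x, l x ≤ r x) ∧ (∃ c : ℝ, ∀ x, r x - l x = c) ∧ ∀ x y, lt x y ↔ r x < l y

/-- The number of ascents of a sequence (entries are indexed from `0`). -/
def asc (x : List ℕ) : ℕ :=
  ((Finset.range (x.length - 1)).filter (fun j => x.getD j 0 < x.getD (j + 1) 0)).card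

/-- Ascent sequences: nonempty sequences of nonnegative integers with first term `0`, each later
term being at most one more than the number of ascents before it. -/
def IsAscentSequence (x : List ℕ) : Prop :=
  x.head? = some 0 ∧ ∀ i, 1 ≤ i → i < x.length → x.getD i 0 ≤ 1 + asc (x.take i)

/-- The largest term of a (nonempty) sequence. -/
def maxTerm (x : List ℕ) : ℕ := x.max?.getD 0

/-- Restricted ascent sequences: each term after the first is at least `m - 1` (computed in `ℤ`),
where `m` is the largest of the terms before it. -/
def IsRestrictedAscentSequence (x : List ℕ) : Prop :=
  IsAscentSequence x ∧
    ∀ i, 1 ≤ i → i < x.length → (maxTerm (x.take i) : ℤ) - 1 ≤ (x.getD i 0 : ℤ)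

/-- The largest right endpoint of a (nonempty) list of intervals, a pair `(a, b)` standing for
the interval `[a, b]`. -/
def largestRight (Q : List (ℕ × ℕ)) : ℕ := (Q.map Prod.snd).max?.getD 0

/-- The smallest left endpoint among the intervals whose right endpoint is the largest one. -/
def smallestLeft (Q : List (ℕ × ℕ)) : ℕ :=
  ((Q.filter (fun p => p.2 = largestRight Q)).map Prod.fst).min?.getD 0

/-- How an interval `[a, b]` changes when a new endpoint is inserted at `i`, where `L` is the largest
right endpoint: intervals that end at `L` and start before `i` are truncated to `[a, i]`, the other
intervals with `a < i ≤ b` are stretched, those with `i ≤ a` are shifted. -/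
def insertEndpoint (L i : ℕ) (p : ℕ × ℕ) : ℕ × ℕ :=
  if i ≤ p.1 then (p.1 + 1, p.2 + 1)
  else if p.2 = L then (p.1, i)
  else if i ≤ p.2 then (p.1, p.2 + 1)
  else p

/-- One step of the construction: from the minimal endpoint representation of the interval order of
`(x₁, …, xₙ₋₁)` and the term `i = xₙ` to that of the interval order of `(x₁, …, xₙ)`.
The last branch, `i > largestRight Q + 1`, does not occur for ascent sequences. -/
def addPoint (Q : List (ℕ × ℕ)) (i : ℕ) : List (ℕ × ℕ) :=
  if i ≤ smallestLeft Q then (i, largestRight Q) :: Q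
  else if i ≤ largestRight Q then
    (i, largestRight Q + 1) :: Q.map (insertEndpoint (largestRight Q) i)
  else if i = largestRight Q + 1 then (largestRight Q + 1, largestRight Q + 1) :: Q
  else Q

/-- The minimal endpoint representation (as a list of intervals, with repetitions) of the interval
order that corresponds to an ascent sequence, built term by term from `[0, 0]`. -/
def intervalsOf : List ℕ → List (ℕ × ℕ)
  | [] => []
  | _ :: xs => xs.foldl addPoint [(0, 0)]

/-- The strict order on the (indices of the) intervals of a list: one interval lies completely to
the left of the other. -/
def intervalLT (Q : List (ℕ × ℕ)) (a b : Fin Q.length) : Prop := (Q.get a).2 < (Q.get b).1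

/-- `x` is an ascent sequence whose interval order, under the bijection between ascent sequences and
unlabeled interval orders, is isomorphic to `P`; that is, `x` is the image `Ψ(P)` of `P`. -/
def CorrespondsTo (P : Type*) [PartialOrder P] (x : List ℕ) : Prop :=
  IsAscentSequence x ∧
    Nonempty ((fun a b : P => a < b) ≃r intervalLT (intervalsOf x))

/-- `P` is a hereditary semiorder: every nonempty initial part of its ascent sequence corresponds to
a semiorder. -/
def IsHereditary (P : Type*) [PartialOrder P] : Prop :=
  IsSemiorder (fun a b : P => a < b) ∧
    ∃ x, CorrespondsTo P x ∧
      ∀ i, 1 ≤ i → i ≤ x.length → IsSemiorder (intervalLT (intervalsOf (x.take i)))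

/-! A finite interval order has a unique minimal representation: the endpoints are 0, …, L and each
value is both a left and a right endpoint. Left endpoints rank the elements by their strict
down-sets, right endpoints by their strict up-sets, so an isomorphism preserves the intervals
(`perm_of_relIso`, `exists_isMinimal`). The step `addPoint` keeps minimality, and the added term
becomes the smallest left endpoint `s` of an interval ending at the top; `L` grows exactly when the
term exceeds the old `s`, that is, at an ascent. Hence the last term can be read off and the step
undone (`addPoint_injective`, `exists_addPoint`), which gives existence and uniqueness of the ascent
sequence.

An interval order is a semiorder iff its minimal representation is `Unnested`. While this holds, the
maximum `m` of the sequence satisfies: `m - 1` is the largest left endpoint of an interval not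
ending at `L` (`TracksMax`). A term below `m - 1` therefore adds an interval ending at `L` strictly
around such an interval, and the semiorder property fails at once. A term at least `m - 1` can
create a nested pair only by splitting at an inner endpoint, and then the outer interval ends below
the new top. Such a pair survives every later step (`DeeplyNested`), so it cannot occur if the final
order is a semiorder. -/

/-! ### Multisets of intervals and isomorphism of their orders. -/

/-- Two families with the same multiset of values differ by a bijection of the index types. -/
theorem exists_equiv_of_map_univ_eq {α β γ : Type*} [Fintype α] [Fintype β]
    {f : α → γ} {g : β → γ} (h : Finset.univ.val.map f = Finset.univ.val.map g) :
    ∃ e : α ≃ β, ∀ a, g (e a) = f a := by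
  classical
  have key : ∀ c, Nonempty ({ a // f a = c } ≃ { b // g b = c }) := by
    intro c
    rw [← Fintype.card_eq, Fintype.card_subtype, Fintype.card_subtype]
    have := congrArg (Multiset.count c) h
    rw [Multiset.count_map, Multiset.count_map] at this
    simpa [Finset.card_def, Finset.filter_val, eq_comm] using this
  exact ⟨Equiv.ofFiberEquiv fun c => (key c).some, fun a => Equiv.ofFiberEquiv_map _ a⟩

/-- A representation of a relation by the intervals of a list transfers to the list. -/
theorem nonempty_relIso_intervalLT {X : Type*} [Fintype X] {r : X → X → Prop} {φ : X → ℕ × ℕ}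
    (hr : ∀ a b, r a b ↔ (φ a).2 < (φ b).1) {Q : List (ℕ × ℕ)}
    (hQ : Finset.univ.val.map φ = (Q : Multiset (ℕ × ℕ))) : Nonempty (r ≃r intervalLT Q) := by
  obtain ⟨e, he⟩ := exists_equiv_of_map_univ_eq (f := φ) (g := Q.get) (by
    rw [hQ, Fin.univ_val_map, List.ofFn_get])
  exact ⟨⟨e, by intro a b; rw [intervalLT, he, he, hr]⟩⟩

theorem nonempty_relIso_of_perm {Q R : List (ℕ × ℕ)} (h : Q.Perm R) :
    Nonempty (intervalLT Q ≃r intervalLT R) :=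
  nonempty_relIso_intervalLT (φ := Q.get) (fun _ _ => Iff.rfl) (by
    rw [Fin.univ_val_map, List.ofFn_get]; exact Quotient.sound h)

/-! ### Minimal representations and the construction step. -/

/-- `Q` is the minimal endpoint representation of an interval order: every value in `{0, …, L}` is
both a left and a right endpoint, and `s` is the smallest left endpoint of an interval that ends
at `L`. -/
structure IsMinimal (Q : List (ℕ × ℕ)) (L s : ℕ) : Prop where
  le : ∀ p ∈ Q, p.1 ≤ p.2
  bound : ∀ p ∈ Q, p.2 ≤ L
  left : ∀ k ≤ L, ∃ p ∈ Q, p.1 = k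
  right : ∀ k ≤ L, ∃ p ∈ Q, p.2 = k
  mem : (s, L) ∈ Q
  min : ∀ p ∈ Q, p.2 = L → s ≤ p.1

namespace IsMinimal

variable {Q R : List (ℕ × ℕ)} {L s M t i j : ℕ}

theorem largestRight_eq (h : IsMinimal Q L s) : largestRight Q = L := by
  have : (Q.map Prod.snd).max? = some L := by
    rw [List.max?_eq_some_iff]
    refine ⟨List.mem_map.2 ⟨_, h.mem, rfl⟩, ?_⟩
    intro b hb
    obtain ⟨p, hp, rfl⟩ := List.mem_map.1 hb
    exact h.bound p hp
  simp [largestRight, this]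

theorem smallestLeft_eq (h : IsMinimal Q L s) : smallestLeft Q = s := by
  have : ((Q.filter (fun p => p.2 = largestRight Q)).map Prod.fst).min? = some s := by
    rw [List.min?_eq_some_iff, h.largestRight_eq]
    refine ⟨List.mem_map.2 ⟨_, List.mem_filter.2 ⟨h.mem, by simp⟩, rfl⟩, ?_⟩
    intro b hb
    obtain ⟨p, hp, rfl⟩ := List.mem_map.1 hb
    obtain ⟨hp, hL⟩ := List.mem_filter.1 hp
    exact h.min p hp (by simpa using hL)
  simp [smallestLeft, this]

theorem le_L (h : IsMinimal Q L s) : s ≤ L := h.le _ h.mem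

theorem perm (h : IsMinimal Q L s) (hp : Q.Perm R) : IsMinimal R L s where
  le p m := h.le p (hp.mem_iff.2 m)
  bound p m := h.bound p (hp.mem_iff.2 m)
  left k hk := let ⟨p, m, e⟩ := h.left k hk; ⟨p, hp.mem_iff.1 m, e⟩
  right k hk := let ⟨p, m, e⟩ := h.right k hk; ⟨p, hp.mem_iff.1 m, e⟩
  mem := hp.mem_iff.1 h.mem
  min p m := h.min p (hp.mem_iff.2 m)

theorem unique (h : IsMinimal Q L s) (h' : IsMinimal Q M t) : L = M ∧ s = t :=
  ⟨h.largestRight_eq.symm.trans h'.largestRight_eq,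
    h.smallestLeft_eq.symm.trans h'.smallestLeft_eq⟩

theorem addPoint_low (h : IsMinimal Q L s) (hi : i ≤ s) : addPoint Q i = (i, L) :: Q := by
  simp [addPoint, h.smallestLeft_eq, h.largestRight_eq, hi]

theorem addPoint_mid (h : IsMinimal Q L s) (hi : s < i) (hL : i ≤ L) :
    addPoint Q i = (i, L + 1) :: Q.map (insertEndpoint L i) := by
  simp [addPoint, h.smallestLeft_eq, h.largestRight_eq, hi.not_ge, hL]

theorem addPoint_high (h : IsMinimal Q L s) : addPoint Q (L + 1) = (L + 1, L + 1) :: Q := by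
  have := h.le_L
  simp [addPoint, h.smallestLeft_eq, h.largestRight_eq, show ¬ L + 1 ≤ s by omega]

/-- The three cases of the construction. -/
theorem addPoint_cases (h : IsMinimal Q L s) (hi : i ≤ L + 1) :
    (i ≤ s ∧ addPoint Q i = (i, L) :: Q) ∨
    (s < i ∧ i ≤ L ∧ addPoint Q i = (i, L + 1) :: Q.map (insertEndpoint L i)) ∨
    (s < i ∧ i = L + 1 ∧ addPoint Q i = (L + 1, L + 1) :: Q) := by
  rcases le_or_gt i s with h1 | h1
  · exact Or.inl ⟨h1, h.addPoint_low h1⟩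
  rcases le_or_gt i L with h2 | h2
  · exact Or.inr (Or.inl ⟨h1, h2, h.addPoint_mid h1 h2⟩)
  · obtain rfl : i = L + 1 := by omega
    exact Or.inr (Or.inr ⟨h1, rfl, h.addPoint_high⟩)

theorem addPoint_perm (h : IsMinimal Q L s) (hi : i ≤ L + 1) (hp : Q.Perm R) :
    (addPoint Q i).Perm (addPoint R i) := by
  have h' := h.perm hp
  rcases h.addPoint_cases hi with ⟨h1, e⟩ | ⟨h1, h2, e⟩ | ⟨h1, rfl, e⟩
  · rw [e, h'.addPoint_low h1]; exact hp.cons _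
  · rw [e, h'.addPoint_mid h1 h2]; exact (hp.map _).cons _
  · rw [e, h'.addPoint_high]; exact hp.cons _

/-- The construction preserves minimality, and the new smallest left endpoint is the term added. -/
theorem addPoint (h : IsMinimal Q L s) (hi : i ≤ L + 1) :
    IsMinimal (addPoint Q i) (if i ≤ s then L else L + 1) i := by
  have hsL := h.le_L
  rcases h.addPoint_cases hi with ⟨h1, e⟩ | ⟨h1, h2, e⟩ | ⟨h1, rfl, e⟩
  · rw [e, if_pos h1]
    refine ⟨?_, ?_, ?_, ?_, by simp, ?_⟩
    · rintro p (_ | ⟨_, hp⟩)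
      · exact h1.trans hsL
      · exact h.le p hp
    · rintro p (_ | ⟨_, hp⟩)
      · exact le_rfl
      · exact h.bound p hp
    · intro k hk
      obtain ⟨p, hp, e⟩ := h.left k hk
      exact ⟨p, List.mem_cons_of_mem _ hp, e⟩
    · intro k hk
      obtain ⟨p, hp, e⟩ := h.right k hk
      exact ⟨p, List.mem_cons_of_mem _ hp, e⟩
    · rintro p (_ | ⟨_, hp⟩) hL
      · exact le_rfl
      · exact h1.trans (h.min p hp hL)
  · rw [e, if_neg h1.not_ge]
    have hmap : ∀ p ∈ Q, insertEndpoint L i p ∈ (i, L + 1) :: Q.map (insertEndpoint L i) :=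
      fun p hp => List.mem_cons_of_mem _ (List.mem_map_of_mem hp)
    refine ⟨?_, ?_, ?_, ?_, by simp, ?_⟩
    · rintro p (_ | ⟨_, hp⟩)
      · exact hi
      · obtain ⟨q, hq, rfl⟩ := List.mem_map.1 hp
        have := h.le q hq
        simp only [insertEndpoint]
        split_ifs <;> (try dsimp only) <;> omega
    · rintro p (_ | ⟨_, hp⟩)
      · exact le_rfl
      · obtain ⟨q, hq, rfl⟩ := List.mem_map.1 hp
        have := h.bound q hq
        simp only [insertEndpoint]
        split_ifs <;> (try dsimp only) <;> omega
    · intro k hk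
      rcases lt_trichotomy k i with hki | rfl | hki
      · obtain ⟨p, hp, rfl⟩ := h.left k (by omega)
        refine ⟨_, hmap p hp, ?_⟩
        simp only [insertEndpoint]
        split_ifs <;> first | rfl | omega
      · exact ⟨_, List.mem_cons_self, rfl⟩
      · obtain ⟨p, hp, e⟩ := h.left (k - 1) (by omega)
        refine ⟨_, hmap p hp, ?_⟩
        simp only [insertEndpoint]
        split_ifs <;> (try dsimp only) <;> omega
    · intro k hk
      rcases lt_trichotomy k i with hki | rfl | hki
      · obtain ⟨p, hp, rfl⟩ := h.right k (by omega)
        have := h.le p hp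
        refine ⟨_, hmap p hp, ?_⟩
        simp only [insertEndpoint]
        split_ifs <;> (try dsimp only) <;> omega
      -- The value `i` becomes a right endpoint by truncating `(s, L)`, which is possible because `s
      -- < i`.
      · refine ⟨_, hmap _ h.mem, ?_⟩
        simp [insertEndpoint, h1.not_ge]
      · rcases Nat.lt_or_ge k (L + 1) with hkL | hkL
        · obtain ⟨p, hp, e⟩ := h.right (k - 1) (by omega)
          refine ⟨_, hmap p hp, ?_⟩
          simp only [insertEndpoint]
          split_ifs <;> (try dsimp only) <;> omega
        · exact ⟨_, List.mem_cons_self, by simp only; omega⟩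
    · rintro p (_ | ⟨_, hp⟩) hL
      · exact le_rfl
      · obtain ⟨q, hq, rfl⟩ := List.mem_map.1 hp
        have := h.bound q hq
        revert hL
        simp only [insertEndpoint]
        split_ifs <;> (try dsimp only) <;> omega
  · rw [e, if_neg h1.not_ge]
    refine ⟨?_, ?_, ?_, ?_, by simp, ?_⟩
    · rintro p (_ | ⟨_, hp⟩)
      · exact le_rfl
      · exact h.le p hp
    · rintro p (_ | ⟨_, hp⟩)
      · exact le_rfl
      · exact (h.bound p hp).trans (Nat.le_succ L)
    · intro k hk
      rcases hk.lt_or_eq with hk | rfl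
      · obtain ⟨p, hp, e⟩ := h.left k (by omega)
        exact ⟨p, List.mem_cons_of_mem _ hp, e⟩
      · exact ⟨_, List.mem_cons_self, rfl⟩
    · intro k hk
      rcases hk.lt_or_eq with hk | rfl
      · obtain ⟨p, hp, e⟩ := h.right k (by omega)
        exact ⟨p, List.mem_cons_of_mem _ hp, e⟩
      · exact ⟨_, List.mem_cons_self, rfl⟩
    · rintro p (_ | ⟨_, hp⟩) hL
      · exact le_rfl
      · have := h.bound p hp
        omega

end IsMinimal

/-! ### Undoing a construction step. -/

/-- The inverse of `insertEndpoint L i`. -/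
def removeEndpoint (L i : ℕ) (p : ℕ × ℕ) : ℕ × ℕ :=
  if i < p.1 then (p.1 - 1, p.2 - 1)
  else if p.2 = i then (p.1, L)
  else if i < p.2 then (p.1, p.2 - 1)
  else p

theorem removeEndpoint_insertEndpoint {L i : ℕ} {p : ℕ × ℕ} (hp : p.1 ≤ p.2) :
    removeEndpoint L i (insertEndpoint L i p) = p := by
  obtain ⟨a, b⟩ := p
  grind [removeEndpoint, insertEndpoint]

/-- The hypotheses on `p` describe what is left of a middle-case result once the added interval `(i,
L + 1)` is taken away: nothing else starts at `i`, and whatever still ends at the top starts after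
`i`. -/
theorem insertEndpoint_removeEndpoint {L i : ℕ} {p : ℕ × ℕ} (hp : p.1 ≤ p.2) (hL : p.2 ≤ L + 1)
    (hpi : p.1 ≠ i) (hLi : p.2 = L + 1 → i < p.1) (hi : i ≤ L) :
    insertEndpoint L i (removeEndpoint L i p) = p := by
  obtain ⟨a, b⟩ := p
  grind [removeEndpoint, insertEndpoint]

/-- Separates the middle case from the low one, where an older interval still starts at `i`. -/
theorem insertEndpoint_fst_ne (L i : ℕ) (p : ℕ × ℕ) : (insertEndpoint L i p).1 ≠ i := by
  simp only [insertEndpoint]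
  split_ifs <;> (try dsimp only) <;> omega

namespace IsMinimal

variable {Q R : List (ℕ × ℕ)} {L s M t i j : ℕ}

/-- The construction step is injective up to the order of the list. -/
theorem addPoint_injective (hQ : IsMinimal Q L s) (hR : IsMinimal R M t) (hi : i ≤ L + 1)
    (hj : j ≤ M + 1) (hp : (_root_.addPoint Q i).Perm (_root_.addPoint R j)) :
    i = j ∧ Q.Perm R := by
  -- Both terms are the smallest left endpoint of a top interval of the same result, hence equal; it
  -- remains to see that the two steps were of the same kind.
  obtain ⟨hLM, rfl⟩ := ((hQ.addPoint hi).perm hp).unique (hR.addPoint hj)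
  refine ⟨rfl, ?_⟩
  have hsL := hQ.le_L
  have htM := hR.le_L
  rcases hQ.addPoint_cases hi with ⟨h1, e⟩ | ⟨h1, h2, e⟩ | ⟨h1, h2, e⟩ <;>
  rcases hR.addPoint_cases hj with ⟨h1', e'⟩ | ⟨h1', h2', e'⟩ | ⟨h1', h2', e'⟩ <;>
  simp only [h1, h1', not_le_of_gt, if_true, if_false] at hLM <;>
  rw [e, e'] at hp
  · rw [hLM] at hp; exact hp.cons_inv
  · rw [hLM] at hp
    obtain ⟨p, hp1, hp2⟩ := hQ.left i (by omega)
    obtain ⟨q, -, rfl⟩ := List.mem_map.1 (hp.cons_inv.mem_iff.1 hp1)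
    exact (insertEndpoint_fst_ne _ _ _ hp2).elim
  · rw [hLM, h2'] at hp
    obtain ⟨p, hp1, hp2⟩ := hQ.left i (by omega)
    have hp3 := hp.cons_inv.mem_iff.1 hp1
    have := hR.le p hp3
    have := hR.bound p hp3
    omega
  · rw [hLM] at hp
    obtain ⟨p, hp1, hp2⟩ := hR.left i (by omega)
    obtain ⟨q, -, rfl⟩ := List.mem_map.1 (hp.cons_inv.mem_iff.2 hp1)
    exact (insertEndpoint_fst_ne _ _ _ hp2).elim
  · obtain rfl : L = M := by omega
    have := hp.cons_inv.map (removeEndpoint L i)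
    rw [List.map_map, List.map_map, List.map_congr_left (g := id), List.map_id,
      List.map_congr_left (g := id), List.map_id] at this
    · exact this
    · exact fun p hp => removeEndpoint_insertEndpoint (hR.le p hp)
    · exact fun p hp => removeEndpoint_insertEndpoint (hQ.le p hp)
  · omega
  · rw [← hLM, h2] at hp
    obtain ⟨p, hp1, hp2⟩ := hR.left i (by omega)
    have hp3 := hp.cons_inv.mem_iff.2 hp1
    have := hQ.le p hp3
    have := hQ.bound p hp3
    omega
  · omega
  · rw [hLM] at hp; exact hp.cons_inv

/-- Every minimal representation with more than one interval arises by a construction step. -/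
theorem exists_addPoint (hR : IsMinimal R L s) (hlen : 2 ≤ R.length) :
    ∃ Q M t, IsMinimal Q M t ∧ s ≤ M + 1 ∧ (_root_.addPoint Q s).Perm R ∧
      R.length = Q.length + 1 := by
  have hpR := List.perm_cons_erase hR.mem
  set T := R.erase (s, L) with hT
  have hlenT : R.length = T.length + 1 := by rw [hpR.length_eq]; rfl
  have hsL := hR.le_L
  have h := hR.perm hpR
  have hTle : ∀ p ∈ T, p.1 ≤ p.2 := fun p hp => h.le p (List.mem_cons_of_mem _ hp)
  have hTbd : ∀ p ∈ T, p.2 ≤ L := fun p hp => h.bound p (List.mem_cons_of_mem _ hp)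
  have hTmin : ∀ p ∈ T, p.2 = L → s ≤ p.1 := fun p hp => h.min p (List.mem_cons_of_mem _ hp)
  have hTleft : ∀ k ≤ L, k ≠ s → ∃ p ∈ T, p.1 = k := by
    intro k hk hks
    obtain ⟨p, _ | ⟨_, hp⟩, e⟩ := h.left k hk
    · exact (hks e.symm).elim
    · exact ⟨p, hp, e⟩
  have hTright : ∀ k ≤ L, k ≠ L → ∃ p ∈ T, p.2 = k := by
    intro k hk hks
    obtain ⟨p, _ | ⟨_, hp⟩, e⟩ := h.right k hk
    · exact (hks e.symm).elim
    · exact ⟨p, hp, e⟩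
  -- The kind of the last step is visible after removing `(s, L)`: low if another interval starts at
  -- `s`; otherwise high if `s = L`, and middle if `s < L`.
  by_cases hs : ∃ p ∈ T, p.1 = s
  · have hleft : ∀ k ≤ L, ∃ p ∈ T, p.1 = k := fun k hk =>
      if e : k = s then e ▸ hs else hTleft k hk e
    have hLmem : ∃ p ∈ T, p.2 = L := by
      obtain ⟨p, hp, e⟩ := hleft L le_rfl
      exact ⟨p, hp, le_antisymm (hTbd p hp) (e ▸ hTle p hp)⟩
    classical
    have hex : ∃ t, (t, L) ∈ T := by
      obtain ⟨⟨a, b⟩, hp, rfl⟩ := hLmem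
      exact ⟨a, hp⟩
    have hM : IsMinimal T L (Nat.find hex) := by
      refine ⟨hTle, hTbd, hleft, ?_, Nat.find_spec hex, ?_⟩
      · intro k hk
        by_cases e : k = L
        · exact e ▸ hLmem
        · exact hTright k hk e
      · rintro ⟨a, b⟩ hp rfl
        exact Nat.find_min' hex hp
    refine ⟨T, L, _, hM, by omega, ?_, hlenT⟩
    rw [hM.addPoint_low (hTmin _ (Nat.find_spec hex) rfl)]
    exact hpR.symm
  push Not at hs
  rcases hsL.eq_or_lt with rfl | hlt
  · have hTlt : ∀ p ∈ T, p.2 < s := by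
      intro p hp
      have h1 := hTle p hp
      have h2 := hTbd p hp
      have h3 := hTmin p hp
      have h4 := hs p hp
      omega
    obtain ⟨p₀, hp₀⟩ : ∃ p, p ∈ T := List.exists_mem_of_length_pos (by omega)
    have hpos := hTlt p₀ hp₀
    classical
    have hex : ∃ t, (t, s - 1) ∈ T := by
      obtain ⟨⟨a, b⟩, hp, e⟩ := hTright (s - 1) (by omega) (by omega)
      exact ⟨a, by simp only at e; exact e ▸ hp⟩
    have hM : IsMinimal T (s - 1) (Nat.find hex) := by
      refine ⟨hTle, fun p hp => Nat.le_sub_one_of_lt (hTlt p hp),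
        fun k hk => hTleft k (by omega) (by omega), fun k hk => hTright k (by omega) (by omega),
        Nat.find_spec hex, ?_⟩
      rintro ⟨a, b⟩ hp rfl
      exact Nat.find_min' hex hp
    refine ⟨T, s - 1, _, hM, by omega, ?_, hlenT⟩
    have := hM.addPoint_high
    rw [Nat.sub_add_cancel (by omega)] at this
    rw [this]
    exact hpR.symm
  · obtain ⟨K, rfl⟩ : ∃ K, L = K + 1 := ⟨L - 1, by omega⟩
    have hsK : s ≤ K := by omega
    have hinv : ∀ p ∈ T, insertEndpoint K s (removeEndpoint K s p) = p := by
      intro p hp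
      refine insertEndpoint_removeEndpoint (hTle p hp) (hTbd p hp) (hs p hp) ?_ hsK
      intro e
      exact lt_of_le_of_ne (hTmin p hp e) (Ne.symm (hs p hp))
    have hmap : ∀ p ∈ T, removeEndpoint K s p ∈ T.map (removeEndpoint K s) :=
      fun p hp => List.mem_map_of_mem hp
    -- An interval ending at `s` was truncated by the step. Restored, it ends at `K` and starts
    -- below `s`, so `K` is again a right endpoint and the recovered smallest left endpoint is below
    -- `s`.
    obtain ⟨q, hqT, hq⟩ := hTright s (by omega) (by omega)
    have hq1 : q.1 < s := lt_of_le_of_ne (hq ▸ hTle q hqT) (hs q hqT)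
    have hqm : (q.1, K) ∈ T.map (removeEndpoint K s) := by
      have := hmap q hqT
      simpa [removeEndpoint, hq, hq1.not_gt] using this
    have hex : ∃ t, (t, K) ∈ T.map (removeEndpoint K s) := ⟨_, hqm⟩
    classical
    have hM : IsMinimal (T.map (removeEndpoint K s)) K (Nat.find hex) := by
      refine ⟨?_, ?_, ?_, ?_, Nat.find_spec hex, ?_⟩
      · intro p hp
        obtain ⟨r, hr, rfl⟩ := List.mem_map.1 hp
        have h1 := hTle r hr
        have h2 := hs r hr
        simp only [removeEndpoint]
        split_ifs <;> (try dsimp only) <;> omega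
      · intro p hp
        obtain ⟨r, hr, rfl⟩ := List.mem_map.1 hp
        have h1 := hTbd r hr
        simp only [removeEndpoint]
        split_ifs <;> (try dsimp only) <;> omega
      · intro k hk
        rcases Nat.lt_or_ge k s with hks | hks
        · obtain ⟨p, hp, rfl⟩ := hTleft k (by omega) (by omega)
          refine ⟨_, hmap p hp, ?_⟩
          simp only [removeEndpoint]
          split_ifs <;> first | rfl | omega
        · obtain ⟨p, hp, e⟩ := hTleft (k + 1) (by omega) (by omega)
          refine ⟨_, hmap p hp, ?_⟩
          simp only [removeEndpoint]
          split_ifs <;> (try dsimp only) <;> omega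
      · intro k hk
        rcases Nat.lt_or_ge k s with hks | hks
        · obtain ⟨p, hp, rfl⟩ := hTright k (by omega) (by omega)
          have := hTle p hp
          refine ⟨_, hmap p hp, ?_⟩
          simp only [removeEndpoint]
          split_ifs <;> (try dsimp only) <;> omega
        rcases hk.eq_or_lt with rfl | hk
        · exact ⟨_, hqm, rfl⟩
        · obtain ⟨p, hp, e⟩ := hTright (k + 1) (by omega) (by omega)
          refine ⟨_, hmap p hp, ?_⟩
          simp only [removeEndpoint]
          split_ifs <;> (try dsimp only) <;> omega
      · rintro ⟨a, b⟩ hp rfl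
        exact Nat.find_min' hex hp
    refine ⟨_, K, _, hM, by omega, ?_, by simpa using hlenT⟩
    rw [hM.addPoint_mid ((Nat.find_min' hex hqm).trans_lt hq1) hsK, List.map_map,
      List.map_congr_left (f := _ ∘ _) (g := id) hinv, List.map_id]
    exact hpR.symm

end IsMinimal

/-! ### Appending a term to a sequence. -/

theorem take_concat_of_le {x : List ℕ} {i k : ℕ} (hk : k ≤ x.length) :
    (x ++ [i]).take k = x.take k := List.take_append_of_le_length hk

theorem getD_concat_of_lt {x : List ℕ} {i k : ℕ} (hk : k < x.length) :
    (x ++ [i]).getD k 0 = x.getD k 0 := by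
  simp [List.getElem?_append_left hk]

theorem getD_concat_length (x : List ℕ) (i : ℕ) : (x ++ [i]).getD x.length 0 = i := by
  simp

theorem asc_concat {x : List ℕ} (hx : x ≠ []) (i : ℕ) :
    asc (x ++ [i]) = asc x + if x.getD (x.length - 1) 0 < i then 1 else 0 := by
  obtain ⟨n, hn⟩ : ∃ n, x.length = n + 1 :=
    ⟨x.length - 1, by have := List.length_pos_iff.2 hx; omega⟩
  have hl : (x ++ [i]).length - 1 = n + 1 := by simp [hn]
  have hlast := getD_concat_length x i
  rw [hn] at hlast
  rw [asc, asc, hl, hn, Finset.range_add_one, Finset.filter_insert, hlast,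
    getD_concat_of_lt (by omega : n < x.length), Nat.add_sub_cancel]
  have : (Finset.range n).filter (fun j => (x ++ [i]).getD j 0 < (x ++ [i]).getD (j + 1) 0) =
      (Finset.range n).filter (fun j => x.getD j 0 < x.getD (j + 1) 0) := by
    refine Finset.filter_congr fun j hj => ?_
    rw [Finset.mem_range] at hj
    rw [getD_concat_of_lt (by omega), getD_concat_of_lt (by omega)]
  rw [this]
  split_ifs
  · rw [Finset.card_insert_of_notMem (by simp)]
  · rfl

/-- A condition on the terms after the first of a sequence extended by one term. -/
theorem forall_concat_iff {x : List ℕ} (hx : x ≠ []) (i : ℕ) (C : List ℕ → ℕ → Prop) :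
    (∀ k, 1 ≤ k → k < (x ++ [i]).length → C ((x ++ [i]).take k) ((x ++ [i]).getD k 0)) ↔
      (∀ k, 1 ≤ k → k < x.length → C (x.take k) (x.getD k 0)) ∧ C x i := by
  have hpos := List.length_pos_iff.2 hx
  constructor
  · intro h
    refine ⟨fun k hk hkx => ?_, ?_⟩
    · have := h k hk (by simp; omega)
      rwa [take_concat_of_le hkx.le, getD_concat_of_lt hkx] at this
    · have := h x.length hpos (by simp)
      rwa [take_concat_of_le le_rfl, getD_concat_length, List.take_length] at this
  · rintro ⟨h, hi⟩ k hk hkx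
    rw [List.length_append, List.length_singleton] at hkx
    rcases (Nat.lt_succ_iff.1 hkx).lt_or_eq with hlt | rfl
    · rw [take_concat_of_le hlt.le, getD_concat_of_lt hlt]
      exact h k hk hlt
    · rwa [take_concat_of_le le_rfl, getD_concat_length, List.take_length]

theorem isAscentSequence_concat {x : List ℕ} (hx : x ≠ []) (i : ℕ) :
    IsAscentSequence (x ++ [i]) ↔ IsAscentSequence x ∧ i ≤ 1 + asc x := by
  rw [IsAscentSequence, IsAscentSequence, forall_concat_iff hx i fun y j => j ≤ 1 + asc y,
    List.head?_append_of_ne_nil _ hx, and_assoc]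

theorem isRestrictedAscentSequence_concat {x : List ℕ} (hx : x ≠ []) (i : ℕ) :
    IsRestrictedAscentSequence (x ++ [i]) ↔
      IsRestrictedAscentSequence x ∧ i ≤ 1 + asc x ∧ maxTerm x ≤ i + 1 := by
  rw [IsRestrictedAscentSequence, IsRestrictedAscentSequence, isAscentSequence_concat hx,
    forall_concat_iff hx i fun y j => (maxTerm y : ℤ) - 1 ≤ (j : ℤ)]
  have : (maxTerm x : ℤ) - 1 ≤ (i : ℤ) ↔ maxTerm x ≤ i + 1 := by omega
  rw [this]
  tauto

theorem maxTerm_concat (x : List ℕ) (i : ℕ) : maxTerm (x ++ [i]) = max (maxTerm x) i := by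
  cases x with
  | nil => simp [maxTerm]
  | cons a xs => rw [maxTerm, maxTerm, List.cons_append, List.max?_cons', List.max?_cons',
      List.foldl_append]; rfl

theorem intervalsOf_concat {x : List ℕ} (hx : x ≠ []) (i : ℕ) :
    intervalsOf (x ++ [i]) = addPoint (intervalsOf x) i := by
  cases x with
  | nil => exact (hx rfl).elim
  | cons a xs => simp [intervalsOf, List.foldl_append]

theorem IsAscentSequence.ne_nil {x : List ℕ} (hx : IsAscentSequence x) : x ≠ [] := by
  rintro rfl
  simpa using hx.1

theorem isAscentSequence_singleton : IsAscentSequence [0] :=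
  ⟨rfl, fun i hi hi' => by simp at hi'; omega⟩

/-- Induction on ascent sequences by appending terms. -/
theorem IsAscentSequence.concat_induction {C : ∀ x, IsAscentSequence x → Prop}
    (h0 : C [0] isAscentSequence_singleton)
    (hstep : ∀ x i (hx : IsAscentSequence x) (hi : i ≤ 1 + asc x), C x hx →
      C (x ++ [i]) ((isAscentSequence_concat hx.ne_nil i).2 ⟨hx, hi⟩))
    {x : List ℕ} (hx : IsAscentSequence x) : C x hx := by
  induction x using List.reverseRecOn with
  | nil => exact (hx.ne_nil rfl).elim
  | append_singleton x i ih =>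
    rcases eq_or_ne x [] with rfl | hne
    · have := hx.1
      simp only [List.nil_append, List.head?_cons, Option.some.injEq] at this
      subst this
      exact h0
    · obtain ⟨h1, h2⟩ := (isAscentSequence_concat hne i).1 hx
      exact hstep x i h1 h2 (ih h1)

/-! ### Ascent sequences correspond to minimal representations. -/

theorem isMinimal_singleton : IsMinimal [(0, 0)] 0 0 := by
  constructor <;> simp

/-- The intervals of an ascent sequence form a minimal representation; the number of ascents is the
largest endpoint and the last term is the smallest left endpoint of a maximal interval. -/
theorem IsAscentSequence.isMinimal {x : List ℕ} (hx : IsAscentSequence x) :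
    IsMinimal (intervalsOf x) (asc x) (x.getD (x.length - 1) 0) := by
  induction hx using IsAscentSequence.concat_induction with
  | h0 => exact isMinimal_singleton
  | hstep x i hx hi ih =>
    have := ih.addPoint (i := i) (by omega)
    have hlen : (x ++ [i]).length - 1 = x.length := by simp
    rw [intervalsOf_concat hx.ne_nil, asc_concat hx.ne_nil, hlen, getD_concat_length]
    convert this using 1
    split_ifs <;> omega

theorem IsMinimal.length_addPoint {Q : List (ℕ × ℕ)} {L s i : ℕ} (h : IsMinimal Q L s)
    (hi : i ≤ L + 1) : (_root_.addPoint Q i).length = Q.length + 1 := by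
  rcases h.addPoint_cases hi with ⟨-, e⟩ | ⟨-, -, e⟩ | ⟨-, -, e⟩ <;> rw [e] <;> simp

theorem IsAscentSequence.length_intervalsOf {x : List ℕ} (hx : IsAscentSequence x) :
    (intervalsOf x).length = x.length := by
  induction hx using IsAscentSequence.concat_induction with
  | h0 => rfl
  | hstep x i hx hi ih =>
    rw [intervalsOf_concat hx.ne_nil, hx.isMinimal.length_addPoint (by omega), ih]
    simp

/-- An ascent sequence is determined by its multiset of intervals. -/
theorem IsAscentSequence.eq_of_perm {x y : List ℕ} (hx : IsAscentSequence x)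
    (hy : IsAscentSequence y) (h : (intervalsOf x).Perm (intervalsOf y)) : x = y := by
  induction hx using IsAscentSequence.concat_induction generalizing y with
  | h0 =>
    induction hy using IsAscentSequence.concat_induction with
    | h0 => rfl
    | hstep y j hy hj _ =>
      have h1 := h.length_eq
      rw [intervalsOf_concat hy.ne_nil, hy.isMinimal.length_addPoint (by omega),
        hy.length_intervalsOf] at h1
      have := List.length_pos_iff.2 hy.ne_nil
      simp only [intervalsOf, List.foldl_nil, List.length_singleton] at h1
      omega
  | hstep x i hx hi ih =>
    induction hy using IsAscentSequence.concat_induction with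
    | h0 =>
      have h1 := h.length_eq
      rw [intervalsOf_concat hx.ne_nil, hx.isMinimal.length_addPoint (by omega),
        hx.length_intervalsOf] at h1
      have := List.length_pos_iff.2 hx.ne_nil
      simp only [intervalsOf, List.foldl_nil, List.length_singleton] at h1
      omega
    | hstep y j hy hj _ =>
      rw [intervalsOf_concat hx.ne_nil, intervalsOf_concat hy.ne_nil] at h
      obtain ⟨rfl, h'⟩ := hx.isMinimal.addPoint_injective hy.isMinimal (by omega) (by omega) h
      rw [ih hy h']

/-- Every minimal representation is that of an ascent sequence. -/
theorem IsMinimal.exists_isAscentSequence {R : List (ℕ × ℕ)} {L s : ℕ} (h : IsMinimal R L s) :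
    ∃ x, IsAscentSequence x ∧ (intervalsOf x).Perm R := by
  obtain ⟨n, hn⟩ : ∃ n, R.length = n + 1 :=
    ⟨R.length - 1, by have := List.length_pos_of_mem h.mem; omega⟩
  induction n generalizing R L s with
  | zero =>
    obtain ⟨p, rfl⟩ := List.length_eq_one_iff.1 hn
    have h1 := h.left 0 (Nat.zero_le _)
    have h2 := h.right 0 (Nat.zero_le _)
    simp only [List.mem_singleton, exists_eq_left] at h1 h2
    refine ⟨[0], isAscentSequence_singleton, ?_⟩
    rw [show p = (0, 0) from Prod.ext h1 h2]
    exact List.Perm.refl _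
  | succ n ih =>
    obtain ⟨Q, M, t, hQ, hs, hp, hlen⟩ := h.exists_addPoint (by omega)
    obtain ⟨x, hx, hxQ⟩ := ih hQ (by omega)
    obtain ⟨hM, -⟩ := (hx.isMinimal.perm hxQ).unique hQ
    refine ⟨x ++ [s], (isAscentSequence_concat hx.ne_nil s).2 ⟨hx, by omega⟩, ?_⟩
    rw [intervalsOf_concat hx.ne_nil]
    exact (hx.isMinimal.addPoint_perm (by omega) hxQ).trans hp

/-! ### Uniqueness of the minimal representation. -/

/-- A strictly monotone comparison of two rank functions, the first of which attains every value
below each of its values. -/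
theorem le_of_lt_imp_lt {α : Type*} {u v : α → ℕ} (huv : ∀ a b, u a < u b → v a < v b)
    (hu : ∀ a, ∀ j < u a, ∃ b, u b = j) (a : α) : u a ≤ v a := by
  obtain ⟨n, hn⟩ : ∃ n, u a = n := ⟨_, rfl⟩
  induction n generalizing a with
  | zero => omega
  | succ n ih =>
    obtain ⟨b, hb⟩ := hu a n (by omega)
    have := huv b a (by omega)
    have := ih b hb
    omega

namespace IsMinimal

variable {Q R : List (ℕ × ℕ)} {L s M t : ℕ}

theorem exists_left (h : IsMinimal Q L s) {k : ℕ} (hk : k ≤ L) : ∃ a, (Q.get a).1 = k := by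
  obtain ⟨p, hp, e⟩ := h.left k hk
  obtain ⟨a, rfl⟩ := List.get_of_mem hp
  exact ⟨a, e⟩

theorem exists_right (h : IsMinimal Q L s) {k : ℕ} (hk : k ≤ L) : ∃ a, (Q.get a).2 = k := by
  obtain ⟨p, hp, e⟩ := h.right k hk
  obtain ⟨a, rfl⟩ := List.get_of_mem hp
  exact ⟨a, e⟩

theorem snd_get_le (h : IsMinimal Q L s) (a : Fin Q.length) : (Q.get a).2 ≤ L :=
  h.bound _ (List.get_mem Q a)

theorem fst_get_le (h : IsMinimal Q L s) (a : Fin Q.length) : (Q.get a).1 ≤ (Q.get a).2 :=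
  h.le _ (List.get_mem Q a)

/-- The order of left endpoints is intrinsic to the poset. By minimality some interval ends exactly
where that of `a` starts, and it serves as the witness `c`. -/
theorem fst_lt_fst_iff (h : IsMinimal Q L s) (a b : Fin Q.length) :
    (Q.get a).1 < (Q.get b).1 ↔ ∃ c, intervalLT Q c b ∧ ¬ intervalLT Q c a := by
  constructor
  · intro hab
    obtain ⟨c, hc⟩ := h.exists_right (k := (Q.get a).1) ((h.fst_get_le a).trans (h.snd_get_le a))
    exact ⟨c, by rw [intervalLT]; omega, by rw [intervalLT]; omega⟩
  · rintro ⟨c, h1, h2⟩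
    rw [intervalLT] at h1 h2
    omega

theorem snd_lt_snd_iff (h : IsMinimal Q L s) (a b : Fin Q.length) :
    (Q.get a).2 < (Q.get b).2 ↔ ∃ c, intervalLT Q a c ∧ ¬ intervalLT Q b c := by
  constructor
  · intro hab
    obtain ⟨c, hc⟩ := h.exists_left (h.snd_get_le b)
    exact ⟨c, by rw [intervalLT]; omega, by rw [intervalLT]; omega⟩
  · rintro ⟨c, h1, h2⟩
    rw [intervalLT] at h1 h2
    omega

/-- Left endpoints have an intrinsic order and fill an initial segment, so no isomorphism can lower
them; applied to the inverse as well, this gives equality. -/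
theorem fst_get_le_of_relIso (hQ : IsMinimal Q L s) (hR : IsMinimal R M t)
    (f : intervalLT Q ≃r intervalLT R) (a : Fin Q.length) : (Q.get a).1 ≤ (R.get (f a)).1 := by
  refine le_of_lt_imp_lt (u := fun a => (Q.get a).1) (v := fun a => (R.get (f a)).1) ?_ ?_ a
  · intro a b hab
    obtain ⟨c, h1, h2⟩ := (hQ.fst_lt_fst_iff a b).1 hab
    exact (hR.fst_lt_fst_iff _ _).2 ⟨f c, f.map_rel_iff.2 h1, fun h => h2 (f.map_rel_iff.1 h)⟩
  · exact fun a j hj => hQ.exists_left (hj.le.trans ((hQ.fst_get_le a).trans (hQ.snd_get_le a)))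

theorem snd_get_le_of_relIso (hQ : IsMinimal Q L s) (hR : IsMinimal R M t)
    (f : intervalLT Q ≃r intervalLT R) (a : Fin Q.length) : (Q.get a).2 ≤ (R.get (f a)).2 := by
  refine le_of_lt_imp_lt (u := fun a => (Q.get a).2) (v := fun a => (R.get (f a)).2) ?_ ?_ a
  · intro a b hab
    obtain ⟨c, h1, h2⟩ := (hQ.snd_lt_snd_iff a b).1 hab
    exact (hR.snd_lt_snd_iff _ _).2 ⟨f c, f.map_rel_iff.2 h1, fun h => h2 (f.map_rel_iff.1 h)⟩
  · exact fun a j hj => hQ.exists_right (hj.le.trans (hQ.snd_get_le a))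

/-- Minimal representations of isomorphic interval orders agree up to the order of the list. -/
theorem perm_of_relIso (hQ : IsMinimal Q L s) (hR : IsMinimal R M t)
    (f : intervalLT Q ≃r intervalLT R) : Q.Perm R := by
  have key : ∀ a, R.get (f a) = Q.get a := by
    intro a
    refine Prod.ext (le_antisymm ?_ (hQ.fst_get_le_of_relIso hR f a))
      (le_antisymm ?_ (hQ.snd_get_le_of_relIso hR f a))
    · simpa using hR.fst_get_le_of_relIso hQ f.symm (f a)
    · simpa using hR.snd_get_le_of_relIso hQ f.symm (f a)
  have h1 : (Finset.univ.val.map (R.get ∘ f.toEquiv)) = Finset.univ.val.map R.get := by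
    rw [← Multiset.map_map, Multiset.map_univ_val_equiv]
  have h2 : R.get ∘ f.toEquiv = Q.get := funext key
  rw [h2, Fin.univ_val_map, Fin.univ_val_map, List.ofFn_get, List.ofFn_get] at h1
  exact Quotient.exact h1

end IsMinimal

/-! ### Existence of the minimal representation. -/

/-- A function on a finite type can be compressed to one whose values form an initial segment. -/
theorem exists_rank {X : Type*} [Fintype X] (u : X → ℕ) :
    ∃ v : X → ℕ, (∀ a b, v a < v b ↔ u a < u b) ∧ ∀ a, ∀ j < v a, ∃ b, v b = j := by
  classical
  -- The number of distinct values of `u` below `k`.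
  let v : ℕ → ℕ := fun k => ((Finset.univ.image u).filter (· < k)).card
  have hmono : ∀ j k, j ≤ k → v j ≤ v k := fun j k hjk =>
    Finset.card_le_card (Finset.monotone_filter_right _ fun _ _ h => lt_of_lt_of_le h hjk)
  have hlt : ∀ a k, u a < k → v (u a) < v k := fun a k h =>
    Finset.card_lt_card ⟨Finset.monotone_filter_right _ fun _ _ h' => h'.trans h,
      fun hsub => lt_irrefl (u a) (Finset.mem_filter.1 (hsub (Finset.mem_filter.2
        ⟨Finset.mem_image_of_mem u (Finset.mem_univ a), h⟩))).2⟩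
  refine ⟨fun a => v (u a), fun a b => ⟨fun h => ?_, hlt a _⟩, ?_⟩
  · by_contra hab
    exact absurd (hmono _ _ (not_lt.1 hab)) (not_le.2 h)
  · intro a
    induction hk : u a using Nat.strong_induction_on generalizing a with
    | _ k ih =>
      subst hk
      intro j hj
      change j < v (u a) at hj
      have hne : ((Finset.univ.image u).filter (· < u a)).Nonempty :=
        Finset.card_pos.1 (show 0 < v (u a) by omega)
      obtain ⟨hm1, hm2⟩ := Finset.mem_filter.1 (Finset.max'_mem _ hne)
      obtain ⟨b, -, hb⟩ := Finset.mem_image.1 hm1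
      rw [← hb] at hm2
      have hle : v (u a) ≤ v (u b) + 1 := by
        have : (Finset.univ.image u).filter (· < u a) ⊆
            insert (u b) ((Finset.univ.image u).filter (· < u b)) := by
          intro c hc
          have h1 := Finset.le_max' _ c hc
          rw [← hb] at h1
          rcases h1.eq_or_lt with rfl | h1
          · exact Finset.mem_insert_self _ _
          · exact Finset.mem_insert_of_mem (Finset.mem_filter.2 ⟨(Finset.mem_filter.1 hc).1, h1⟩)
        exact (Finset.card_le_card this).trans (Finset.card_insert_le _ _)
      rcases (show j ≤ v (u b) by omega).eq_or_lt with rfl | hjb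
      · exact ⟨b, rfl⟩
      · exact ih (u b) hm2 b rfl j hjb

/-- Every nonempty finite interval order has a minimal representation. -/
theorem exists_isMinimal {X : Type*} [Finite X] [Nonempty X] {lt : X → X → Prop} {l r : X → ℝ}
    (hle : ∀ x, l x ≤ r x) (hlt : ∀ x y, lt x y ↔ r x < l y) :
    ∃ Q L s, IsMinimal Q L s ∧ Nonempty (lt ≃r intervalLT Q) := by
  classical
  cases nonempty_fintype X
  -- Strict down-sets of an interval order form a chain under inclusion, so their cardinalities rank
  -- them; the rank is the left endpoint.
  let D : X → Finset X := fun y => Finset.univ.filter (lt · y)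
  have hD : ∀ x y, x ∈ D y ↔ lt x y := fun x y => by simp [D]
  have hchain : ∀ x y z, lt x z → ¬ lt x y → D y ⊂ D z := by
    intro x y z h1 h2
    rw [hlt] at h1 h2
    refine ⟨fun w hw => ?_, fun h => h2 ?_⟩
    · rw [hD, hlt] at hw ⊢
      linarith
    · exact (hlt _ _).1 ((hD _ _).1 (h ((hD _ _).2 ((hlt _ _).2 h1))))
  obtain ⟨v, hv, hinit⟩ := exists_rank fun y => (D y).card
  have hlt' : ∀ x y z, lt x z → ¬ lt x y → v y < v z := fun x y z h1 h2 =>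
    (hv _ _).2 (Finset.card_lt_card (hchain x y z h1 h2))
  have hex : ∀ y z, v y < v z → ∃ x, lt x z ∧ ¬ lt x y := by
    intro y z h
    by_contra! hcon
    refine absurd ((hv _ _).1 h) (not_lt.2 (Finset.card_le_card fun x hx => ?_))
    exact (hD _ _).2 (hcon x ((hD _ _).1 hx))
  have hirr : ∀ x, ¬ lt x x := fun x h => absurd ((hlt x x).1 h) (not_lt.2 (hle x))
  -- The right endpoint of `x` is the largest left endpoint of an element not above `x`.
  let w : X → ℕ := fun x => (Finset.univ.filter fun y => ¬ lt x y).sup v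
  have hw : ∀ x y, ¬ lt x y → v y ≤ w x := fun x y h =>
    Finset.le_sup (f := v) (Finset.mem_filter.2 ⟨Finset.mem_univ y, h⟩)
  have hw' : ∀ x, ∃ y, ¬ lt x y ∧ w x = v y := by
    intro x
    obtain ⟨y, hy, e⟩ := Finset.exists_mem_eq_sup (Finset.univ.filter fun y => ¬ lt x y)
      ⟨x, by simpa using hirr x⟩ v
    exact ⟨y, (Finset.mem_filter.1 hy).2, e⟩
  have hrep : ∀ x y, lt x y ↔ w x < v y := by
    intro x y
    constructor
    · intro h
      obtain ⟨z, hz, e⟩ := hw' x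
      rw [e]
      exact hlt' x z y h hz
    · intro h
      by_contra hxy
      exact absurd (hw x y hxy) (not_le.2 h)
  let φ : X → ℕ × ℕ := fun x => (v x, w x)
  let Q := (Finset.univ.val.map φ).toList
  have hQ : Finset.univ.val.map φ = (Q : Multiset (ℕ × ℕ)) := (Multiset.coe_toList _).symm
  have hmem : ∀ p, p ∈ Q ↔ ∃ x, φ x = p := by
    intro p
    rw [Multiset.mem_toList, Multiset.mem_map]
    simp
  have hmemφ : ∀ x, φ x ∈ Q := fun x => (hmem _).2 ⟨x, rfl⟩
  obtain ⟨m, hm⟩ := Finite.exists_max v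
  have hwm : ∀ x, w x ≤ v m := fun x => by
    obtain ⟨y, -, e⟩ := hw' x
    exact e ▸ hm y
  have hvex : ∀ k ≤ v m, ∃ x, v x = k := by
    intro k hk
    rcases hk.eq_or_lt with rfl | hk
    · exact ⟨m, rfl⟩
    · exact hinit m k hk
  have hmm : φ m ∈ Q ∧ w m = v m := ⟨hmemφ m, le_antisymm (hwm m) (hw m m (hirr m))⟩
  have hsex : ∃ s, (s, v m) ∈ Q := ⟨v m, by have := hmemφ m; simp only [φ, hmm.2] at this; exact this⟩
  refine ⟨Q, v m, Nat.find hsex, ⟨?_, ?_, ?_, ?_, Nat.find_spec hsex, ?_⟩,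
    nonempty_relIso_intervalLT hrep hQ⟩
  · intro p hp
    obtain ⟨x, rfl⟩ := (hmem p).1 hp
    exact hw x x (hirr x)
  · intro p hp
    obtain ⟨x, rfl⟩ := (hmem p).1 hp
    exact hwm x
  · intro k hk
    obtain ⟨x, hx⟩ := hvex k hk
    exact ⟨φ x, hmemφ x, hx⟩
  · intro k hk
    rcases hk.eq_or_lt with rfl | hk
    · exact ⟨_, hmm⟩
    · obtain ⟨y, hy⟩ := hvex k hk.le
      obtain ⟨z, hz⟩ := hvex (k + 1) hk
      -- An element below `z` (rank `k + 1`) but not below `y` (rank `k`) has right endpoint exactly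
      -- `k`.
      obtain ⟨x, hxz, hxy⟩ := hex y z (by omega)
      refine ⟨φ x, hmemφ x, le_antisymm ?_ (hy ▸ hw x y hxy)⟩
      obtain ⟨q, hq, e⟩ := hw' x
      have := hlt' x q z hxz hq
      simp only [φ]
      omega
  · rintro ⟨a, b⟩ hp rfl
    exact Nat.find_min' hsex hp

/-! ### Semiorders are the interval orders with unnested minimal representation. -/

theorem IsSemiorder.of_relIso {X Y : Type*} {lt : X → X → Prop} {lt' : Y → Y → Prop}
    (h : IsSemiorder lt) (e : lt ≃r lt') : IsSemiorder lt' := by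
  obtain ⟨l, r, h1, ⟨c, h2⟩, h3⟩ := h
  refine ⟨l ∘ e.symm, r ∘ e.symm, fun y => h1 _, ⟨c, fun y => h2 _⟩, fun x y => ?_⟩
  rw [← e.symm.map_rel_iff, h3]
  rfl

/-- No interval of the list lies strictly inside another one. -/
def Unnested (Q : List (ℕ × ℕ)) : Prop :=
  ∀ p ∈ Q, ∀ q ∈ Q, p.1 < q.1 → p.2 ≤ q.2

/-- If `b` lies strictly inside `a`, minimality supplies `x` ending just before `b` and `y` starting
just after it. In any representation `a` must then reach from `x` to `y`, with `b` strictly between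
them, so `a` is longer than `b`. -/
theorem IsMinimal.unnested_of_isSemiorder {Q : List (ℕ × ℕ)} {L s : ℕ} (h : IsMinimal Q L s)
    (hs : IsSemiorder (intervalLT Q)) : Unnested Q := by
  obtain ⟨l, r, h1, ⟨c, h2⟩, h3⟩ := hs
  intro p hp q hq hpq
  obtain ⟨a, rfl⟩ := List.get_of_mem hp
  obtain ⟨b, rfl⟩ := List.get_of_mem hq
  by_contra! hlt
  have hb := h.fst_get_le b
  have ha := h.snd_get_le a
  obtain ⟨x, hx⟩ := h.exists_right (k := (Q.get b).1 - 1) (by omega)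
  obtain ⟨y, hy⟩ := h.exists_left (k := (Q.get b).2 + 1) (by omega)
  have e1 := (h3 x b).1 (by rw [intervalLT]; omega)
  have e2 := (h3 b y).1 (by rw [intervalLT]; omega)
  have e3 := mt (h3 x a).2 (by rw [intervalLT]; omega)
  have e4 := mt (h3 a y).2 (by rw [intervalLT]; omega)
  have := h2 a
  have := h2 b
  linarith

/-- A finite sequence of reals that is increasing and in which the terms that lie more than `1`
below the `k`-th one are prescribed to be those with index less than `t k`. -/
theorem exists_unit_spaced {t : ℕ → ℕ} (hmono : Monotone t) (ht : ∀ k, t k ≤ k) (n : ℕ) :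
    ∃ f : ℕ → ℝ, (∀ k < n, ∀ j < k, f j < f k) ∧ (∀ k < n, ∀ j < t k, f j + 1 < f k) ∧
      ∀ k < n, ∀ j < n, t k ≤ j → f k < f j + 1 := by
  induction n with
  | zero => exact ⟨fun _ => 0, by simp, by simp, by simp⟩
  | succ n ih =>
    obtain ⟨f, h1, h2, h3⟩ := ih
    have htn := ht n
    have hf : ∀ j k, j ≤ k → k < n → f j ≤ f k := by
      intro j k hjk hk
      rcases hjk.eq_or_lt with rfl | hjk
      · exact le_rfl
      · exact (h1 k hk j hjk).le
    -- The new term needs finitely many strict lower and upper bounds; they are compatible by `h3`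
    -- with monotonicity of `t`, and by `h1`.
    obtain ⟨y, hy1, hy2⟩ := Order.exists_between_finsets
      ((Finset.range n).image f ∪ (Finset.range (t n)).image (fun j => f j + 1))
      ((Finset.Ico (t n) n).image (fun j => f j + 1)) (by
        simp only [Finset.mem_union, Finset.mem_image, Finset.mem_range, Finset.mem_Ico]
        rintro _ (⟨j, hj, rfl⟩ | ⟨j, hj, rfl⟩) _ ⟨k, ⟨hk1, hk2⟩, rfl⟩
        · exact h3 j hj k hk2 ((hmono hj.le).trans hk1)
        · have := h1 k hk2 j (by omega)
          linarith)
    simp only [Finset.mem_union, Finset.mem_image, Finset.mem_range, Finset.mem_Ico] at hy1 hy2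
    have e1 : ∀ j < n, f j < y := fun j hj => hy1 _ (Or.inl ⟨j, hj, rfl⟩)
    have e2 : ∀ j < t n, f j + 1 < y := fun j hj => hy1 _ (Or.inr ⟨j, hj, rfl⟩)
    have e3 : ∀ j < n, t n ≤ j → y < f j + 1 := fun j hj hj' => hy2 _ ⟨j, ⟨hj', hj⟩, rfl⟩
    have hlt : ∀ j < n, Function.update f n y j = f j := fun j hj =>
      Function.update_of_ne hj.ne _ _
    refine ⟨Function.update f n y, ?_, ?_, ?_⟩
    · intro k hk j hj
      rw [hlt j (by omega)]
      rcases (Nat.lt_succ_iff.1 hk).lt_or_eq with hk | rfl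
      · rw [hlt k hk]; exact h1 k hk j hj
      · rw [Function.update_self]; exact e1 j hj
    · intro k hk j hj
      have := ht k
      rw [hlt j (by omega)]
      rcases (Nat.lt_succ_iff.1 hk).lt_or_eq with hk | rfl
      · rw [hlt k hk]; exact h2 k hk j hj
      · rw [Function.update_self]; exact e2 j hj
    · intro k hk j hj hkj
      rcases (Nat.lt_succ_iff.1 hk).lt_or_eq with hk | rfl <;>
      rcases (Nat.lt_succ_iff.1 hj).lt_or_eq with hj | rfl
      · rw [hlt k hk, hlt j hj]; exact h3 k hk j hj hkj
      · rw [hlt k hk, Function.update_self]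
        linarith [e1 k hk]
      · rw [hlt j hj, Function.update_self]; exact e3 j hj hkj
      · linarith

/-- Without nesting, the sum of the endpoints sorts the intervals by both endpoints at once, and the
elements before a given one are those whose sum is below a monotone threshold. Unit intervals placed
by `exists_unit_spaced` realize this. -/
theorem IsMinimal.isSemiorder_of_unnested {Q : List (ℕ × ℕ)} {L s : ℕ} (h : IsMinimal Q L s)
    (hu : Unnested Q) : IsSemiorder (intervalLT Q) := by
  classical
  let key : Fin Q.length → ℕ := fun a => (Q.get a).1 + (Q.get a).2
  have hu' : ∀ a b, (Q.get a).1 < (Q.get b).1 → (Q.get a).2 ≤ (Q.get b).2 := fun a b =>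
    hu _ (List.get_mem Q a) _ (List.get_mem Q b)
  have hkey : ∀ a b, key a ≤ key b → (Q.get a).1 ≤ (Q.get b).1 ∧ (Q.get a).2 ≤ (Q.get b).2 := by
    intro a b hab
    simp only [key] at hab
    have := hu' a b
    have := hu' b a
    omega
  have hltkey : ∀ a b, intervalLT Q a b → key a < key b := by
    intro a b hab
    rw [intervalLT] at hab
    have := h.fst_get_le a
    have := h.fst_get_le b
    simp only [key]
    omega
  -- `t k` is one more than the largest key of an element preceding some element of key at most `k`,
  -- or `0` if there is none.
  let S : ℕ → Finset (Fin Q.length × Fin Q.length) := fun k =>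
    Finset.univ.filter fun z => key z.2 ≤ k ∧ intervalLT Q z.1 z.2
  let t : ℕ → ℕ := fun k => (S k).sup fun z => key z.1 + 1
  have hmono : Monotone t := fun j k hjk => Finset.sup_mono
    (Finset.monotone_filter_right _ fun z _ hz => ⟨hz.1.trans hjk, hz.2⟩)
  have ht : ∀ k, t k ≤ k := fun k => Finset.sup_le fun z hz => by
    obtain ⟨-, h1, h2⟩ := Finset.mem_filter.1 hz
    exact (Nat.succ_le_of_lt (hltkey _ _ h2)).trans h1
  have hiff : ∀ a b, intervalLT Q a b ↔ key a < t (key b) := by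
    intro a b
    constructor
    · intro hab
      exact Nat.lt_of_succ_le (Finset.le_sup (f := fun z => key z.1 + 1) (b := (a, b))
        (Finset.mem_filter.2 ⟨Finset.mem_univ _, le_rfl, hab⟩))
    · intro hab
      obtain ⟨z, hz, hlt⟩ := Finset.lt_sup_iff.1 hab
      obtain ⟨-, h1, h2⟩ := Finset.mem_filter.1 hz
      have e1 := hkey a z.1 (Nat.lt_succ_iff.1 hlt)
      have e2 := hkey z.2 b h1
      rw [intervalLT] at h2 ⊢
      omega
  obtain ⟨f, -, h2, h3⟩ := exists_unit_spaced hmono ht ((Finset.univ.sup key) + 1)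
  have hbd : ∀ a, key a < Finset.univ.sup key + 1 := fun a =>
    Nat.lt_succ_of_le (Finset.le_sup (Finset.mem_univ a))
  refine ⟨fun a => f (key a), fun a => f (key a) + 1, fun a => by simp,
    ⟨1, fun a => by ring⟩, fun a b => ?_⟩
  rw [hiff]
  refine ⟨h2 _ (hbd b) _, fun hab => ?_⟩
  by_contra hcon
  exact absurd (h3 _ (hbd b) _ (hbd a) (not_lt.1 hcon)) (not_lt.2 hab.le)

/-! ### Persistent nesting and the maximum of the sequence. -/

/-- Some interval that does not end at `L` strictly contains another one. -/
def DeeplyNested (Q : List (ℕ × ℕ)) (L : ℕ) : Prop :=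
  ∃ p ∈ Q, ∃ q ∈ Q, p.1 < q.1 ∧ q.2 < p.2 ∧ p.2 < L

/-- If `m ≠ 0`, then `m - 1` is the largest left endpoint of an interval that does not end at `L`;
if `m = 0`, then there is no such interval. -/
def TracksMax (Q : List (ℕ × ℕ)) (L m : ℕ) : Prop :=
  (∀ p ∈ Q, p.2 < L → p.1 + 1 ≤ m) ∧ (m = 0 ∨ ∃ p ∈ Q, p.2 < L ∧ m ≤ p.1 + 1)

theorem DeeplyNested.not_unnested {Q : List (ℕ × ℕ)} {L : ℕ} (h : DeeplyNested Q L) :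
    ¬ Unnested Q := by
  obtain ⟨p, hp, q, hq, h1, h2, -⟩ := h
  exact fun hu => absurd (hu p hp q hq h1) (not_le.2 h2)

namespace IsMinimal

variable {Q : List (ℕ × ℕ)} {L s i m : ℕ}

/-- Only intervals ending at `L` get truncated; on all others, insertion is strictly monotone in
each endpoint and keeps the right one below the new top. -/
theorem deeplyNested_addPoint (h : IsMinimal Q L s) (hi : i ≤ L + 1) (hd : DeeplyNested Q L) :
    DeeplyNested (_root_.addPoint Q i) (if i ≤ s then L else L + 1) := by
  obtain ⟨p, hp, q, hq, h1, h2, h3⟩ := hd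
  rcases h.addPoint_cases hi with ⟨hs, e⟩ | ⟨hs, hL, e⟩ | ⟨hs, hL, e⟩
  · rw [e, if_pos hs]
    exact ⟨p, List.mem_cons_of_mem _ hp, q, List.mem_cons_of_mem _ hq, h1, h2, h3⟩
  · rw [e, if_neg hs.not_ge]
    refine ⟨_, List.mem_cons_of_mem _ (List.mem_map_of_mem hp), _,
      List.mem_cons_of_mem _ (List.mem_map_of_mem hq), ?_⟩
    have := h.le p hp
    have := h.le q hq
    simp only [insertEndpoint]
    split_ifs <;> (try dsimp only) <;> omega
  · rw [e, if_neg hs.not_ge]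
    exact ⟨p, List.mem_cons_of_mem _ hp, q, List.mem_cons_of_mem _ hq, h1, h2, by omega⟩

/-- Otherwise `p` would lie strictly inside `(s, L)`. -/
theorem fst_le_of_unnested (h : IsMinimal Q L s) (hu : Unnested Q) :
    ∀ p ∈ Q, p.2 < L → p.1 ≤ s := by
  intro p hp hpL
  by_contra! hlt
  exact absurd (hu _ h.mem p hp hlt) (not_le.2 hpL)

theorem fst_le_of_unnested_addPoint (h : IsMinimal Q L s) (hu : Unnested Q)
    (hu' : Unnested (_root_.addPoint Q i)) : ∀ p ∈ Q, p.2 < L → p.1 ≤ i := by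
  intro p hp hpL
  rcases le_or_gt i s with hs | hs
  · rw [h.addPoint_low hs] at hu'
    by_contra! hlt
    exact absurd (hu' _ List.mem_cons_self p (List.mem_cons_of_mem _ hp) hlt) (not_le.2 hpL)
  · exact (h.fst_le_of_unnested hu p hp hpL).trans hs.le

/-- A step that creates a nested pair without adding an interval below the left endpoints of the
non-maximal ones creates one that persists. -/
theorem unnested_or_deeplyNested_addPoint (h : IsMinimal Q L s) (hi : i ≤ L + 1)
    (hu : Unnested Q) (hlow : ∀ p ∈ Q, p.2 < L → p.1 ≤ i) :
    Unnested (_root_.addPoint Q i) ∨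
      DeeplyNested (_root_.addPoint Q i) (if i ≤ s then L else L + 1) := by
  have hst := h.fst_le_of_unnested hu
  rcases h.addPoint_cases hi with ⟨hs, e⟩ | ⟨hs, hL, e⟩ | ⟨hs, hL, e⟩
  · left
    rw [e]
    rintro p (_ | ⟨_, hp⟩) q (_ | ⟨_, hq⟩) hpq
    · exact le_rfl
    · by_contra! hlt
      exact absurd (hlow q hq hlt) (not_le.2 hpq)
    · exact h.bound p hp
    · exact hu p hp q hq hpq
  · rw [or_iff_not_imp_right, e, if_neg hs.not_ge]
    intro hd
    rintro p (_ | ⟨_, hp⟩) q (_ | ⟨_, hq⟩) hpq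
    · exact le_rfl
    · obtain ⟨q, hqQ, rfl⟩ := List.mem_map.1 hq
      have h1 := hst q hqQ
      have h2 := h.bound q hqQ
      revert hpq
      simp only [insertEndpoint]
      split_ifs <;> (try dsimp only) <;> omega
    · obtain ⟨p, hpQ, rfl⟩ := List.mem_map.1 hp
      have h2 := h.bound p hpQ
      simp only [insertEndpoint]
      split_ifs <;> (try dsimp only) <;> omega
    -- An old interval that now ends at `L + 1` was shifted from one ending at `L`; by `hu` the
    -- inner one also ended at `L` and was shifted too. So the outer interval ends below the top.
    · by_contra! hlt
      obtain ⟨p, hpQ, rfl⟩ := List.mem_map.1 hp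
      obtain ⟨q, hqQ, rfl⟩ := List.mem_map.1 hq
      refine hd ⟨_, List.mem_cons_of_mem _ hp, _, List.mem_cons_of_mem _ hq, hpq, hlt, ?_⟩
      have h1 := hst p hpQ
      have h2 := h.bound p hpQ
      have h3 := h.le q hqQ
      have h4 := hu p hpQ q hqQ
      have h5 := h.bound q hqQ
      revert hpq hlt
      simp only [insertEndpoint]
      split_ifs <;> (try dsimp only) <;> omega
  · left
    subst hL
    rw [e]
    rintro p (_ | ⟨_, hp⟩) q (_ | ⟨_, hq⟩) hpq
    · exact le_rfl
    · have h1 := h.le q hq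
      have h2 := h.bound q hq
      simp only at hpq
      omega
    · exact (h.bound p hp).trans (Nat.le_succ L)
    · exact hu p hp q hq hpq

/-- A low step leaves the intervals below the top unchanged, and `i ≤ s ≤ m`. In the other cases `m
≤ s + 1 ≤ i`, and the largest left endpoint below the new top becomes `i - 1`. -/
theorem tracksMax_addPoint (h : IsMinimal Q L s) (hi : i ≤ L + 1) (hu : Unnested Q)
    (ht : TracksMax Q L m) :
    TracksMax (_root_.addPoint Q i) (if i ≤ s then L else L + 1) (max m i) := by
  have hst := h.fst_le_of_unnested hu
  have hsL := h.le_L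
  obtain ⟨h1, h2⟩ := ht
  have hms : m ≤ s + 1 := by
    rcases h2 with rfl | ⟨p, hp, hpL, hm⟩
    · omega
    · have := hst p hp hpL
      omega
  rcases h.addPoint_cases hi with ⟨hs, e⟩ | ⟨hs, hL, e⟩ | ⟨hs, hL, e⟩
  -- An interval starting at `s - 1` cannot end at `L`, by minimality of `s`, so it counts towards
  -- `m`.
  · have hsm : s ≤ m := by
      rcases Nat.eq_zero_or_pos s with h0 | hpos
      · omega
      · obtain ⟨q, hq, hqs⟩ := h.left (s - 1) (by omega)
        have hqL : q.2 < L := lt_of_le_of_ne (h.bound q hq) fun hqL => by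
          have := h.min q hq hqL
          omega
        have := h1 q hq hqL
        omega
    rw [e, if_pos hs, max_eq_left (hs.trans hsm)]
    refine ⟨?_, h2.imp_right fun ⟨p, hp, hp'⟩ => ⟨p, List.mem_cons_of_mem _ hp, hp'⟩⟩
    rintro p (_ | ⟨_, hp⟩) hpL
    · exact (lt_irrefl _ hpL).elim
    · exact h1 p hp hpL
  · rw [e, if_neg hs.not_ge, max_eq_right (by omega : m ≤ i)]
    constructor
    · rintro p (_ | ⟨_, hp⟩) hpL
      · exact (lt_irrefl _ hpL).elim
      · obtain ⟨p, hpQ, rfl⟩ := List.mem_map.1 hp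
        have := hst p hpQ
        revert hpL
        simp only [insertEndpoint]
        split_ifs <;> (try dsimp only) <;> omega
    · right
      obtain ⟨q, hq, hqi⟩ := h.left (i - 1) (by omega)
      have := h.bound q hq
      refine ⟨_, List.mem_cons_of_mem _ (List.mem_map_of_mem hq), ?_⟩
      simp only [insertEndpoint]
      split_ifs <;> (try dsimp only) <;> omega
  · subst hL
    rw [e, if_neg hs.not_ge, max_eq_right (by omega : m ≤ L + 1)]
    constructor
    · rintro p (_ | ⟨_, hp⟩) hpL
      · exact (lt_irrefl _ hpL).elim
      · have := h.le p hp
        omega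
    · right
      obtain ⟨q, hq, hqL⟩ := h.left L le_rfl
      have := h.bound q hq
      exact ⟨q, List.mem_cons_of_mem _ hq, by omega, by omega⟩

end IsMinimal

/-! ### Restricted sequences and hereditary semiorders. -/

/-- Every nonempty initial part of the sequence corresponds to a semiorder. -/
def InitialPartsSemiorder (x : List ℕ) : Prop :=
  ∀ i, 1 ≤ i → i ≤ x.length → IsSemiorder (intervalLT (intervalsOf (x.take i)))

theorem initialPartsSemiorder_concat (x : List ℕ) (i : ℕ) :
    InitialPartsSemiorder (x ++ [i]) ↔
      InitialPartsSemiorder x ∧ IsSemiorder (intervalLT (intervalsOf (x ++ [i]))) := by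
  have hlen : (x ++ [i]).length = x.length + 1 := by simp
  have htake : (x ++ [i]).take (x.length + 1) = x ++ [i] := List.take_of_length_le hlen.le
  constructor
  · intro h
    refine ⟨fun k hk hkx => ?_, ?_⟩
    · have := h k hk (by omega)
      rwa [take_concat_of_le hkx] at this
    · have := h (x.length + 1) (by omega) hlen.ge
      rwa [htake] at this
  · rintro ⟨h1, h2⟩ k hk hkx
    rcases hkx.lt_or_eq with hlt | rfl
    · rw [take_concat_of_le (by omega)]
      exact h1 k hk (by omega)
    · rwa [hlen, htake]

theorem unnested_singleton : Unnested [(0, 0)] := by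
  simp [Unnested]

theorem initialPartsSemiorder_singleton : InitialPartsSemiorder [0] := by
  intro i h1 h2
  obtain rfl : i = 1 := le_antisymm h2 h1
  exact isMinimal_singleton.isSemiorder_of_unnested unnested_singleton

theorem tracksMax_singleton : TracksMax (intervalsOf [0]) (asc [0]) (maxTerm [0]) := by
  simp [TracksMax, intervalsOf, asc, maxTerm]

theorem isRestrictedAscentSequence_singleton : IsRestrictedAscentSequence [0] :=
  ⟨isAscentSequence_singleton, fun i hi hi' => by simp at hi'; omega⟩

theorem asc_concat_eq {x : List ℕ} (hx : x ≠ []) (i : ℕ) :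
    asc (x ++ [i]) = if i ≤ x.getD (x.length - 1) 0 then asc x else asc x + 1 := by
  rw [asc_concat hx]
  split_ifs <;> omega

/-- The initial parts of a restricted ascent sequence correspond to semiorders, unless a nested pair
appears that persists. -/
theorem IsRestrictedAscentSequence.initialPartsSemiorder_or {x : List ℕ}
    (hx : IsRestrictedAscentSequence x) :
    (InitialPartsSemiorder x ∧ Unnested (intervalsOf x) ∧
      TracksMax (intervalsOf x) (asc x) (maxTerm x)) ∨
      DeeplyNested (intervalsOf x) (asc x) := by
  have ha := hx.1
  induction ha using IsAscentSequence.concat_induction with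
  | h0 => exact Or.inl ⟨initialPartsSemiorder_singleton, unnested_singleton, tracksMax_singleton⟩
  | hstep x i ha hi ih =>
    have hne := ha.ne_nil
    obtain ⟨hr, -, hmax⟩ := (isRestrictedAscentSequence_concat hne i).1 hx
    have hQ := ha.isMinimal
    have hi' : i ≤ asc x + 1 := by omega
    rcases ih hr with ⟨h1, h2, h3⟩ | hd
    -- `TracksMax` turns the restriction `maxTerm x ≤ i + 1` into the bound on left endpoints
    -- required here.
    · have hcases := hQ.unnested_or_deeplyNested_addPoint hi' h2 fun p hp hpL => by
        have := h3.1 p hp hpL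
        omega
      have ht := hQ.tracksMax_addPoint hi' h2 h3
      rw [← intervalsOf_concat hne, ← asc_concat_eq hne] at hcases
      rw [← intervalsOf_concat hne, ← asc_concat_eq hne, ← maxTerm_concat] at ht
      refine hcases.imp_left fun hu => ⟨(initialPartsSemiorder_concat x i).2 ⟨h1, ?_⟩, hu, ht⟩
      exact hx.1.isMinimal.isSemiorder_of_unnested hu
    · have := hQ.deeplyNested_addPoint hi' hd
      rw [← intervalsOf_concat hne, ← asc_concat_eq hne] at this
      exact Or.inr this

theorem IsAscentSequence.isRestricted_of_initialPartsSemiorder {x : List ℕ}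
    (hx : IsAscentSequence x) (h : InitialPartsSemiorder x) :
    IsRestrictedAscentSequence x ∧ Unnested (intervalsOf x) ∧
      TracksMax (intervalsOf x) (asc x) (maxTerm x) := by
  induction hx using IsAscentSequence.concat_induction with
  | h0 => exact ⟨isRestrictedAscentSequence_singleton, unnested_singleton, tracksMax_singleton⟩
  | hstep x i ha hi ih =>
    have hne := ha.ne_nil
    have hQ := ha.isMinimal
    have hi' : i ≤ asc x + 1 := by omega
    obtain ⟨h1, h2⟩ := (initialPartsSemiorder_concat x i).1 h
    obtain ⟨hr, hu, ht⟩ := ih h1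
    have hx' := (isAscentSequence_concat hne i).2 ⟨ha, hi⟩
    have hu' := hx'.isMinimal.unnested_of_isSemiorder h2
    have ht' := hQ.tracksMax_addPoint hi' hu ht
    rw [← intervalsOf_concat hne, ← asc_concat_eq hne, ← maxTerm_concat] at ht'
    refine ⟨(isRestrictedAscentSequence_concat hne i).2 ⟨hr, hi, ?_⟩, hu', ht'⟩
    rw [intervalsOf_concat hne] at hu'
    rcases ht.2 with h0 | ⟨p, hp, hpL, hm⟩
    · omega
    · have := hQ.fst_le_of_unnested_addPoint hu hu' p hp hpL
      omega

/-- The hypothesis `hs` serves the forward direction: it excludes a persistent nested pair. -/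
theorem IsAscentSequence.isRestricted_iff {x : List ℕ} (hx : IsAscentSequence x)
    (hs : IsSemiorder (intervalLT (intervalsOf x))) :
    IsRestrictedAscentSequence x ↔ InitialPartsSemiorder x := by
  refine ⟨fun hr => ?_, fun h => (hx.isRestricted_of_initialPartsSemiorder h).1⟩
  rcases hr.initialPartsSemiorder_or with h | h
  · exact h.1
  · exact (h.not_unnested (hx.isMinimal.unnested_of_isSemiorder hs)).elim

theorem theorem6p2 {P : Type*} [PartialOrder P] [Finite P] [Nonempty P]
    (hP : IsSemiorder (fun a b : P => a < b)) :
    ∃ x : List ℕ, CorrespondsTo P x ∧ (∀ y : List ℕ, CorrespondsTo P y → y = x) ∧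
      (IsRestrictedAscentSequence x ↔ IsHereditary P) := by
  have hP' := hP
  obtain ⟨l, r, hle, -, hlt⟩ := hP'
  obtain ⟨Q, L, s, hQ, ⟨e⟩⟩ := exists_isMinimal hle hlt
  obtain ⟨x, hx, hxQ⟩ := hQ.exists_isAscentSequence
  obtain ⟨g⟩ := nonempty_relIso_of_perm hxQ.symm
  have hcorr : CorrespondsTo P x := ⟨hx, ⟨e.trans g⟩⟩
  have huniq : ∀ y : List ℕ, CorrespondsTo P y → y = x := by
    rintro y ⟨hy, ⟨e'⟩⟩
    exact hy.eq_of_perm hx (hy.isMinimal.perm_of_relIso hx.isMinimal (e'.symm.trans (e.trans g)))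
  refine ⟨x, hcorr, huniq, ?_⟩
  rw [hx.isRestricted_iff (hP.of_relIso (e.trans g))]
  constructor
  · exact fun h => ⟨hP, x, hcorr, h⟩
  · rintro ⟨-, y, hy, h⟩
    obtain rfl := huniq y hy
    exact h
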